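/- Let $G=(V,E)$ be a connected (simple, undirected, possibly infinite) graph. A *ray* of $G$ is a one-way infinite path. Two rays are *equivalent* if no finite set of vertices separates them, that is, for every finite $X\subseteq V$ both have a tail in the same component of $G-X$. The equivalence classes are the *ends* of $G$, and $\Omega(G)$ is the set of all ends. For a finite $X\subseteq V$ and an end $\omega$, let $C(X,\omega)$ be the unique component of $G-X$ that contains a tail of every ray in $\omega$. The *end space* of $G$ is $\Omega(G)$ with the topology that has as a basis all sets $\Omega(X,C)=\{\omega\in\Omega(G) : C(X,\omega)=C\}$, where $X\subseteq V$ is finite and $C$ is a component of $G-X$. A topological space is *ultrametrizable* if its topology is induced by an ultrametric, i.e. a metric $d$ with $d(x,z)\le\max\{d(x,y),d(y,z)\}$ for all $x,y,z$. The *tree-order* of a tree $T$ with root $r$ is defined by $u\le v$ if $u$ lies on the unique path from $r$ to $v$ in $T$. A rooted tree $T\subseteq G$ is *normal* in $G$ if the two endvertices of every non-trivial path in $G$ that meets $T$ exactly in its endvertices are comparable in the tree-order of $T$. A subgraph $H\subseteq G$ is *end-faithful* if the natural map $\Omega(H)\to\Omega(G)$, which sends the end of $H$ containing a ray $R\subseteq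 H$ to the end of $G$ containing $R$, is a bijection. **Theorem.** For every connected graph $G$, the following are equivalent: 1. the end space $\Omega(G)$ is metrizable; 2. the end space $\Omega(G)$ is ultrametrizable; 3. $G$ contains an end-faithful normal tree. -/

import Mathlib

namespace SimpleGraph

universe u

/-- A ray (one-way infinite path) of `G`, given by its sequence of vertices
starting at its first vertex. -/
structure Ray {V : Type u} (G : SimpleGraph V) where
  toFun : ℕ → V
  injective : Function.Injective toFun
  adj : ∀ n, G.Adj (toFun n) (toFun (n + 1))

namespace Ray

variable {V : Type u} {G : SimpleGraph V}

/-- The component `C` of `G - X` contains a tail of the ray `R`. -/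
def HasTailIn (R : G.Ray) {X : Finset V} (C : G.ComponentCompl (X : Set V)) : Prop :=
  ∃ N, ∀ n, N ≤ n → R.toFun n ∈ C

theorem exists_hasTailIn (R : G.Ray) (X : Finset V) :
    ∃ C : G.ComponentCompl (X : Set V), R.HasTailIn C := by
  have hfin : (R.toFun ⁻¹' (X : Set V)).Finite := X.finite_toSet.preimage R.injective.injOn
  obtain ⟨M, hM⟩ := hfin.bddAbove
  have hN : ∀ n, M + 1 ≤ n → R.toFun n ∉ (X : Set V) := fun n hn h => by
    have := hM h
    omega
  refine ⟨G.componentComplMk (hN (M + 1) le_rfl), M + 1, fun n hn => ?_⟩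
  induction n, hn using Nat.le_induction with
  | base => exact G.componentComplMk_mem _
  | succ n hn ih => exact ComponentCompl.mem_of_adj _ _ ih (hN _ (by omega)) (R.adj n)

theorem HasTailIn.unique {R : G.Ray} {X : Finset V} {C D : G.ComponentCompl (X : Set V)}
    (hC : R.HasTailIn C) (hD : R.HasTailIn D) : C = D := by
  obtain ⟨M, hM⟩ := hC
  obtain ⟨N, hN⟩ := hD
  obtain ⟨_, h₁⟩ := hM (max M N) (le_max_left _ _)
  obtain ⟨_, h₂⟩ := hN (max M N) (le_max_right _ _)
  exact h₁.symm.trans h₂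

/-- The finite vertex set `X` separates the rays `R` and `S`: they have tails in distinct
components of `G - X`. -/
def SeparatedBy (R S : G.Ray) (X : Finset V) : Prop :=
  ∃ C D : G.ComponentCompl (X : Set V), R.HasTailIn C ∧ S.HasTailIn D ∧ C ≠ D

/-- Two rays are equivalent if no finite set of vertices separates them. -/
def Equivalent (R S : G.Ray) : Prop :=
  ∀ X : Finset V, ¬ R.SeparatedBy S X

theorem Equivalent.hasTailIn {R S : G.Ray} (h : R.Equivalent S) {X : Finset V}
    {C : G.ComponentCompl (X : Set V)} (hC : R.HasTailIn C) : S.HasTailIn C := by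
  obtain ⟨D, hD⟩ := S.exists_hasTailIn X
  have : C = D := by
    by_contra hne
    exact h X ⟨C, D, hC, hD, hne⟩
  exact this ▸ hD

theorem equivalent_of_forall {R S : G.Ray}
    (h : ∀ X : Finset V, ∃ C : G.ComponentCompl (X : Set V), R.HasTailIn C ∧ S.HasTailIn C) :
    R.Equivalent S := by
  rintro X ⟨C, D, hC, hD, hne⟩
  obtain ⟨E, hE, hE'⟩ := h X
  exact hne ((hC.unique hE).trans (hE'.unique hD))

theorem Equivalent.refl (R : G.Ray) : R.Equivalent R :=
  fun _ ⟨_, _, hC, hD, hne⟩ => hne (hC.unique hD)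

theorem Equivalent.symm {R S : G.Ray} (h : R.Equivalent S) : S.Equivalent R :=
  fun X ⟨C, D, hC, hD, hne⟩ => h X ⟨D, C, hD, hC, hne.symm⟩

theorem Equivalent.trans {R S T : G.Ray} (h : R.Equivalent S) (h' : S.Equivalent T) :
    R.Equivalent T :=
  fun _ ⟨_, _, hC, hD, hne⟩ => hne ((h'.hasTailIn (h.hasTailIn hC)).unique hD)

end Ray

/-- Equivalence of rays as a setoid. -/
def raySetoid {V : Type u} (G : SimpleGraph V) : Setoid G.Ray where
  r := Ray.Equivalent
  iseqv := ⟨Ray.Equivalent.refl, Ray.Equivalent.symm, Ray.Equivalent.trans⟩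

/-- The end space `Ω(G)`: its points are the equivalence classes of rays of `G`. -/
def EndSpace {V : Type u} (G : SimpleGraph V) : Type u :=
  Quotient G.raySetoid

namespace EndSpace

variable {V : Type u} {G : SimpleGraph V}

theorem existsUnique_component (X : Finset V) (ω : G.EndSpace) :
    ∃! C : G.ComponentCompl (X : Set V),
      ∀ R : G.Ray, Quotient.mk G.raySetoid R = ω → R.HasTailIn C := by
  induction ω using Quotient.inductionOn with
  | _ S =>
    obtain ⟨C, hC⟩ := S.exists_hasTailIn X
    refine ⟨C, fun R hR => ?_, fun D hD => (hD S rfl).unique hC⟩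
    have h : R.Equivalent S := Quotient.exact hR
    exact h.symm.hasTailIn hC

/-- `C(X, ω)`: the unique component of `G - X` that contains a tail of every ray in `ω`. -/
noncomputable def component (X : Finset V) (ω : G.EndSpace) : G.ComponentCompl (X : Set V) :=
  (existsUnique_component X ω).choose

/-- `Ω(X, C)`: the set of ends `ω` with `C(X, ω) = C`. -/
def basicOpen (X : Finset V) (C : G.ComponentCompl (X : Set V)) : Set G.EndSpace :=
  {ω | component X ω = C}

/-- The topology on `Ω(G)` generated by the sets `Ω(X, C)`, for `X` a finite set of vertices and
`C` a component of `G - X`. -/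
instance : TopologicalSpace G.EndSpace :=
  TopologicalSpace.generateFrom {U | ∃ X : Finset V, ∃ C : G.ComponentCompl (X : Set V),
    U = basicOpen X C}

end EndSpace

namespace Subgraph

variable {V : Type u} {G : SimpleGraph V}

/-- A ray of a subgraph `H` of `G`, viewed as a ray of `G`. -/
def inclRay (H : G.Subgraph) (R : H.coe.Ray) : G.Ray where
  toFun n := (R.toFun n : V)
  injective := Subtype.val_injective.comp R.injective
  adj n := H.adj_sub (R.adj n)

theorem inclRay_equivalent (H : G.Subgraph) {R S : H.coe.Ray} (h : R.Equivalent S) :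
    (H.inclRay R).Equivalent (H.inclRay S) := by
  refine Ray.equivalent_of_forall fun X => ?_
  let Y : Finset H.verts := X.preimage Subtype.val Subtype.val_injective.injOn
  have hY : Set.MapsTo H.hom (Y : Set H.verts)ᶜ (X : Set V)ᶜ := fun v hv hX =>
    hv (by simpa [Y] using hX)
  obtain ⟨D, M, hM⟩ := R.exists_hasTailIn Y
  obtain ⟨N, hN⟩ := h.hasTailIn ⟨M, hM⟩
  have key : ∀ v : H.verts, v ∈ D → (v : V) ∈
      (D.map (induceHom H.hom hY) : G.ComponentCompl (X : Set V)) := by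
    rintro v ⟨hv, rfl⟩
    exact ⟨hY hv, rfl⟩
  exact ⟨D.map (induceHom H.hom hY), ⟨M, fun n hn => key _ (hM n hn)⟩,
    ⟨N, fun n hn => key _ (hN n hn)⟩⟩

/-- The natural inclusion map `Ω(H) → Ω(G)`, sending the class of a ray in `H` to its class
in `G`. -/
def inclEnd (H : G.Subgraph) : H.coe.EndSpace → G.EndSpace :=
  Quotient.map H.inclRay fun _ _ h => H.inclRay_equivalent h

/-- A subgraph `H` of `G` is end-faithful if the inclusion map `Ω(H) → Ω(G)` is a bijection. -/
def IsEndFaithful (H : G.Subgraph) : Prop :=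
  Function.Bijective H.inclEnd

/-- The tree-order of a tree `T` with root `r`: `u ≤ v` if `u` lies on the path
from `r` to `v` in `T`. -/
def TreeLE (T : G.Subgraph) (r u v : T.verts) : Prop :=
  ∃ p : T.coe.Walk r v, p.IsPath ∧ u ∈ p.support

/-- The path `p` of `G` from `u` to `v` is an `H`-path: it is non-trivial and meets `H` exactly in
its endvertices. -/
def IsHPath (H : G.Subgraph) {u v : V} (p : G.Walk u v) : Prop :=
  p.IsPath ∧ u ≠ v ∧ ∀ w, (w ∈ p.support ∧ w ∈ H.verts) ↔ (w = u ∨ w = v)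

/-- `T` is a tree which, with root `r`, is normal in `G`: the endvertices of every `T`-path in `G`
are comparable in the tree-order. -/
def IsNormalTree (T : G.Subgraph) (r : T.verts) : Prop :=
  T.coe.IsTree ∧
    ∀ (u v : T.verts) (p : G.Walk (u : V) (v : V)), T.IsHPath p → T.TreeLE r u v ∨ T.TreeLE r v u

end Subgraph

end SimpleGraph

/-- A topological space is ultrametrizable if its topology is induced by an ultrametric. -/
def IsUltrametrizable (X : Type*) [t : TopologicalSpace X] : Prop :=
  ∃ d : MetricSpace X, d.toUniformSpace.toTopologicalSpace = t ∧ IsUltrametricDist X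

/-!
A metric on the end space is turned into a normal tree by means of *dispersed* sets, the sets of
vertices that can be separated from every end by finitely many vertices.

For every `n`, take a maximal set `𝓡 n` of pairwise disjoint rays whose ends have pairwise
distance at least `1 / (n + 1)`. For fixed `k`, the `k`-th vertices of the rays in `𝓡 n` form a
dispersed set (`isDispersed_of_pairwise_isSeparated`): a small neighbourhood `C(X, ω)` of an end
contains a tail of at most one of these rays, and the other rays with a vertex in `C(X, ω)` have
to meet `X`, so there are at most `|X|` of them as they are disjoint. By the maximality of the
sets `𝓡 n`, no finite set of vertices separates an end from the union of all these countably many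
dispersed sets.

A countable union of dispersed sets is contained in a normal tree
(`exists_isNormalTree_of_isDispersed`). It is found by a depth-first search that always visits
next, in every component of unvisited vertices, a neighbour of the vertex visited last that is
closest to the first of the sets that still meets this component. A vertex of the union that is
never visited would give rise to a ray of the tree with infinitely many vertices of one of the
dispersed sets above it, and no finite set separates these from the end of the ray.

In a normal tree `T`, the vertices below a vertex `t` separate, in `G`, the vertices above `t`
from the rest of the tree (`Subgraph.IsNormalTree.anc_eq_of_reachIn`). Hence a normal tree that
cannot be separated from any end by finitely many vertices is end-faithful: following, from the
root upwards, the vertices below the part of the tree near a given end yields a ray of this end.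
Conversely, if a normal tree contains a ray of every end, then an end is determined by the branch
of the tree that its rays follow, and the end space is embedded in the space of sequences of
vertices of `T`. There the first difference of two sequences defines an ultrametric
(`Subgraph.IsNormalTree.isUltrametrizable`).
-/

/-! ### Walks inside a set, and neighbourhoods of ends -/

namespace SimpleGraph

variable {V : Type*} {G : SimpleGraph V}

/-- `G.ReachIn S u v`: some walk of `G` from `u` to `v` stays inside `S`. -/
def ReachIn (G : SimpleGraph V) (S : Set V) (u v : V) : Prop :=
  ∃ p : G.Walk u v, ∀ w ∈ p.support, w ∈ S

namespace ReachIn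

variable {S S' : Set V} {u v w : V}

theorem refl (h : u ∈ S) : G.ReachIn S u u :=
  ⟨Walk.nil, by simpa using h⟩

theorem symm : G.ReachIn S u v → G.ReachIn S v u := fun ⟨p, hp⟩ =>
  ⟨p.reverse, by simpa using hp⟩

theorem trans : G.ReachIn S u v → G.ReachIn S v w → G.ReachIn S u w := fun ⟨p, hp⟩ ⟨q, hq⟩ =>
  ⟨p.append q, fun x hx => ((Walk.mem_support_append_iff _ _).1 hx).elim (hp x) (hq x)⟩

theorem mono (h : S ⊆ S') : G.ReachIn S u v → G.ReachIn S' u v := fun ⟨p, hp⟩ =>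
  ⟨p, fun w hw => h (hp w hw)⟩

theorem mem_left : G.ReachIn S u v → u ∈ S := fun ⟨p, hp⟩ => hp u p.start_mem_support

theorem mem_right : G.ReachIn S u v → v ∈ S := fun ⟨p, hp⟩ => hp v p.end_mem_support

theorem of_adj (h : G.Adj u v) (hu : u ∈ S) (hv : v ∈ S) : G.ReachIn S u v :=
  ⟨h.toWalk, by simp [hu, hv]⟩

/-- A walk in `S` stays in the part of `S` that can be reached from its first vertex. -/
theorem restrict (h : G.ReachIn S u v) : G.ReachIn {w | G.ReachIn S u w} u v := by
  classical
  obtain ⟨p, hp⟩ := h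
  exact ⟨p, fun w hw => ⟨p.takeUntil w hw, fun x hx =>
    hp x (p.support_takeUntil_subset_support hw hx)⟩⟩

/-- A walk in `S` that ends in another vertex `v` contains a walk avoiding `v`, from the same first
vertex to a neighbour of `v`. -/
theorem exists_adj_end (h : G.ReachIn S u v) (hne : u ≠ v) :
    ∃ y, G.ReachIn (S \ {v}) u y ∧ G.Adj v y := by
  obtain ⟨p, hp⟩ := h
  induction p with
  | nil => exact absurd rfl hne
  | @cons u u' v h p ih =>
    simp only [Walk.support_cons, List.mem_cons, forall_eq_or_imp] at hp
    have hu : u ∈ S \ {v} := ⟨hp.1, hne⟩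
    by_cases hu' : u' = v
    · exact ⟨u, .refl hu, hu' ▸ h.symm⟩
    · obtain ⟨y, hy, hadj⟩ := ih hu' hp.2
      exact ⟨y, (of_adj h hu hy.mem_left).trans hy, hadj⟩

end ReachIn

theorem ComponentCompl.reachIn {K : Set V} {C : G.ComponentCompl K} {u v : V}
    (hu : u ∈ C) (hv : v ∈ C) : G.ReachIn Kᶜ u v := by
  obtain ⟨hu, rfl⟩ := hu
  obtain ⟨hv, h⟩ := hv
  obtain ⟨p⟩ := ConnectedComponent.exact h
  refine ReachIn.symm ⟨p.map (Embedding.induce Kᶜ).toHom, fun w hw => ?_⟩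
  obtain ⟨x, -, rfl⟩ := List.mem_map.1 ((Walk.support_map _ p) ▸ hw)
  exact x.2

theorem ComponentCompl.mem_of_reachIn {K : Set V} {C : G.ComponentCompl K} {u v : V}
    (hu : u ∈ C) (h : G.ReachIn Kᶜ u v) : v ∈ C := by
  obtain ⟨p, hp⟩ := h
  induction p with
  | nil => exact hu
  | cons h p ih =>
    simp only [Walk.support_cons, List.mem_cons, forall_eq_or_imp] at hp
    exact ih (ComponentCompl.mem_of_adj _ _ hu (hp.2 _ p.start_mem_support) h) hp.2

theorem ComponentCompl.mem_mono {K L : Set V} (hKL : K ⊆ L) {C : G.ComponentCompl K}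
    {D : G.ComponentCompl L} {u v : V} (hC : u ∈ C) (hD : u ∈ D) (hv : v ∈ D) : v ∈ C :=
  C.mem_of_reachIn hC ((D.reachIn hD hv).mono (Set.compl_subset_compl.2 hKL))

namespace Ray

variable {R S : G.Ray} {X Y : Finset V}

theorem HasTailIn.mem_mono (hXY : X ⊆ Y) {C : G.ComponentCompl (X : Set V)}
    {D : G.ComponentCompl (Y : Set V)} (hC : R.HasTailIn C) (hD : R.HasTailIn D) {v : V}
    (hv : v ∈ D) : v ∈ C := by
  obtain ⟨M, hM⟩ := hC
  obtain ⟨N, hN⟩ := hD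
  exact ComponentCompl.mem_mono (by exact_mod_cast hXY) (hM _ (le_max_left M N))
    (hN _ (le_max_right M N)) hv

theorem HasTailIn.mono (hXY : X ⊆ Y) {C : G.ComponentCompl (X : Set V)}
    {D : G.ComponentCompl (Y : Set V)} (hC : R.HasTailIn C) (hD : R.HasTailIn D)
    (hS : S.HasTailIn D) : S.HasTailIn C := by
  obtain ⟨N, hN⟩ := hS
  exact ⟨N, fun n hn => hC.mem_mono hXY hD (hN n hn)⟩

/-- A ray meets a finite set only finitely often. -/
theorem exists_forall_notMem (R : G.Ray) (X : Finset V) : ∃ N, ∀ n, N ≤ n → R.toFun n ∉ X := by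
  obtain ⟨C, N, hN⟩ := R.exists_hasTailIn X
  exact ⟨N, fun n hn h => C.notMem_of_mem (hN n hn) (by exact_mod_cast h)⟩

end Ray

namespace EndSpace

variable {X Y : Finset V}

theorem hasTailIn_component (X : Finset V) (R : G.Ray) :
    R.HasTailIn (component X (Quotient.mk G.raySetoid R)) :=
  (existsUnique_component X (Quotient.mk G.raySetoid R)).choose_spec.1 R rfl

theorem component_mk_eq_iff {R : G.Ray} {C : G.ComponentCompl (X : Set V)} :
    component X (Quotient.mk G.raySetoid R) = C ↔ R.HasTailIn C :=
  ⟨fun h => h ▸ hasTailIn_component X R, fun h => (hasTailIn_component X R).unique h⟩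

theorem component_mono (hXY : X ⊆ Y) {ω η : G.EndSpace} (h : component Y ω = component Y η) :
    component X ω = component X η := by
  induction ω using Quotient.inductionOn with | _ R
  induction η using Quotient.inductionOn with | _ S
  have hY := hasTailIn_component Y R
  exact (component_mk_eq_iff.2
    ((hasTailIn_component X R).mono hXY hY (h ▸ hasTailIn_component Y S))).symm

theorem eq_of_forall_component {ω η : G.EndSpace} (h : ∀ X, component X ω = component X η) :
    ω = η := by
  induction ω using Quotient.inductionOn with | _ R
  induction η using Quotient.inductionOn with | _ S
  exact Quotient.sound <| Ray.equivalent_of_forall fun X =>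
    ⟨_, hasTailIn_component X R, h X ▸ hasTailIn_component X S⟩

theorem isOpen_basicOpen (X : Finset V) (C : G.ComponentCompl (X : Set V)) :
    IsOpen (basicOpen X C) :=
  TopologicalSpace.isOpen_generateFrom_of_mem ⟨X, C, rfl⟩

/-- The sets `Ω(X, C(X, ω))` form a neighbourhood basis of the end `ω`. -/
theorem exists_basicOpen_subset {U : Set G.EndSpace} (hU : IsOpen U) {ω : G.EndSpace}
    (hω : ω ∈ U) : ∃ X : Finset V, basicOpen X (component X ω) ⊆ U := by
  classical
  induction hU with
  | basic s hs =>
    obtain ⟨X, C, rfl⟩ := hs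
    exact ⟨X, by rw [show component X ω = C from hω]⟩
  | univ => exact ⟨∅, Set.subset_univ _⟩
  | inter s t _ _ ihs iht =>
    obtain ⟨X, hX⟩ := ihs hω.1
    obtain ⟨Y, hY⟩ := iht hω.2
    exact ⟨X ∪ Y, fun η hη => ⟨hX (component_mono Finset.subset_union_left hη),
      hY (component_mono Finset.subset_union_right hη)⟩⟩
  | sUnion S _ ih =>
    obtain ⟨s, hs, hω⟩ := hω
    obtain ⟨X, hX⟩ := ih s hs hω
    exact ⟨X, hX.trans (Set.subset_sUnion_of_mem hs)⟩

end EndSpace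

/-! ### Levels, ancestors and branches in rooted trees -/

namespace IsTree

variable {W : Type*} {H : SimpleGraph W} (hH : H.IsTree) (r : W)

/-- The unique path from the root `r` to `v`. -/
noncomputable def rootPath (v : W) : H.Walk r v :=
  (hH.existsUnique_path r v).choose

/-- The level of `v`: the length of the path from the root. -/
noncomputable def lev (v : W) : ℕ :=
  (hH.rootPath r v).length

/-- The vertex of level `n` on the path from the root to `v`; it is `v` itself when `n` is at least
the level of `v`. -/
noncomputable def anc (v : W) (n : ℕ) : W :=
  (hH.rootPath r v).getVert n

variable {hH r}

theorem isPath_rootPath (v : W) : (hH.rootPath r v).IsPath :=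
  (hH.existsUnique_path r v).choose_spec.1

theorem eq_rootPath {v : W} {p : H.Walk r v} (hp : p.IsPath) : p = hH.rootPath r v :=
  (hH.existsUnique_path r v).choose_spec.2 p hp

@[simp] theorem anc_zero (v : W) : hH.anc r v 0 = r := by
  simp [anc]

theorem anc_of_lev_le {v : W} {n : ℕ} (h : hH.lev r v ≤ n) : hH.anc r v n = v :=
  Walk.getVert_of_length_le _ h

theorem mem_support_rootPath {u v : W} :
    u ∈ (hH.rootPath r v).support ↔ ∃ n ≤ hH.lev r v, hH.anc r v n = u := by
  rw [Walk.mem_support_iff_exists_getVert]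
  exact ⟨fun ⟨n, h, hn⟩ => ⟨n, hn, h⟩, fun ⟨n, hn, h⟩ => ⟨n, h, hn⟩⟩

theorem rootPath_anc (v : W) (n : ℕ) :
    hH.rootPath r (hH.anc r v n) = (hH.rootPath r v).take n :=
  (eq_rootPath ((isPath_rootPath v).take n)).symm

theorem lev_anc {v : W} {n : ℕ} (h : n ≤ hH.lev r v) : hH.lev r (hH.anc r v n) = n := by
  unfold lev at *
  rw [rootPath_anc]
  exact (Walk.take_length _ n).trans (min_eq_left h)

theorem anc_anc {v : W} {m n : ℕ} (h : m ≤ n) :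
    hH.anc r (hH.anc r v n) m = hH.anc r v m := by
  rw [anc, rootPath_anc]
  refine (Walk.take_getVert _ n m).trans ?_
  rw [Nat.min_eq_right h, anc]

/-- Of two adjacent vertices of a tree, one is the parent of the other. -/
theorem lev_anc_of_adj {v w : W} (h : H.Adj v w) :
    (hH.lev r w = hH.lev r v + 1 ∧ hH.anc r w (hH.lev r v) = v) ∨
      (hH.lev r v = hH.lev r w + 1 ∧ hH.anc r v (hH.lev r w) = w) := by
  have key : ∀ {v w : W} (h : H.Adj v w), w ∉ (hH.rootPath r v).support →
      hH.lev r w = hH.lev r v + 1 ∧ hH.anc r w (hH.lev r v) = v := by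
    intro v w h hw
    have hp := eq_rootPath (hH := hH) ((isPath_rootPath v).concat hw h)
    have hl : hH.lev r w = hH.lev r v + 1 := by
      rw [lev, ← hp, Walk.length_concat, lev]
    refine ⟨hl, ?_⟩
    rw [anc, ← hp, lev, Walk.concat_eq_append, Walk.getVert_append]
    simp
  by_cases hw : w ∈ (hH.rootPath r v).support
  · refine Or.inr (key h.symm fun hv => ?_)
    obtain ⟨n, hn, rfl⟩ := mem_support_rootPath.1 hw
    obtain ⟨m, hm, hv⟩ := mem_support_rootPath.1 hv
    rw [lev_anc hn] at hm
    rw [anc_anc hm] at hv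
    have := lev_anc (hm.trans hn)
    rw [hv] at this
    obtain rfl : n = m := by omega
    rw [hv] at h
    exact h.ne rfl
  · exact Or.inl (key h hw)

theorem anc_eq_of_adj {v w : W} (h : H.Adj v w) {n : ℕ} (hv : n ≤ hH.lev r v)
    (hw : n ≤ hH.lev r w) : hH.anc r v n = hH.anc r w n := by
  rcases lev_anc_of_adj (hH := hH) (r := r) h with ⟨_, h⟩ | ⟨_, h⟩
  · rw [← h, anc_anc hv]
  · rw [← h, anc_anc hw]

theorem adj_anc {v : W} {n : ℕ} (h : n < hH.lev r v) :
    H.Adj (hH.anc r v n) (hH.anc r v (n + 1)) :=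
  Walk.adj_getVert_succ _ h

/-- A vertex `v` above the vertex `t` of level `n` can be reached from `t` inside any set that
contains all vertices of level at least `n`. -/
theorem reachIn_anc {v : W} {n : ℕ} (hn : n ≤ hH.lev r v) {S : Set W}
    (hS : ∀ w, n ≤ hH.lev r w → w ∈ S) : H.ReachIn S (hH.anc r v n) v := by
  suffices ∀ m, n ≤ m → m ≤ hH.lev r v → H.ReachIn S (hH.anc r v n) (hH.anc r v m) by
    simpa [anc_of_lev_le le_rfl] using this _ hn le_rfl
  intro m hm
  induction m, hm using Nat.le_induction with
  | base => exact fun h => .refl (hS _ (lev_anc h).ge)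
  | succ m hm ih =>
    intro h
    refine (ih (by omega)).trans (.of_adj (adj_anc h) (hS _ ?_) (hS _ ?_))
    · rw [lev_anc (by omega)]; exact hm
    · rw [lev_anc h]; omega

/-- The vertices of a ray of a tree eventually agree on their ancestor of level `n`. -/
theorem exists_branch (hH : H.IsTree) (r : W) (R : H.Ray) (n : ℕ) : ∃ t N, ∀ m, N ≤ m →
    n ≤ hH.lev r (R.toFun m) ∧ hH.anc r (R.toFun m) n = t := by
  induction n with
  | zero => exact ⟨r, 0, by simp⟩
  | succ n ih =>
    obtain ⟨t, N, hN⟩ := ih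
    obtain ⟨N', hN'⟩ := R.exists_forall_notMem {t}
    have hlev : ∀ m, max N N' ≤ m → n + 1 ≤ hH.lev r (R.toFun m) := by
      intro m hm
      obtain ⟨h₁, h₂⟩ := hN m (by omega)
      by_contra h
      refine hN' m (by omega) ?_
      rw [Finset.mem_singleton, ← h₂, anc_of_lev_le (by omega)]
    refine ⟨hH.anc r (R.toFun (max N N')) (n + 1), max N N', fun m hm => ⟨hlev m hm, ?_⟩⟩
    induction m, hm using Nat.le_induction with
    | base => rfl
    | succ m hm ih =>
      rw [← ih]
      exact (anc_eq_of_adj (R.adj m) (hlev _ hm) (hlev _ (by omega))).symm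

/-- The vertex of level `n` on the branch of the tree that the ray `R` follows. -/
noncomputable def branch (hH : H.IsTree) (r : W) (R : H.Ray) (n : ℕ) : W :=
  (exists_branch hH r R n).choose

theorem branch_spec (R : H.Ray) (n : ℕ) : ∃ N, ∀ m, N ≤ m →
    n ≤ hH.lev r (R.toFun m) ∧ hH.anc r (R.toFun m) n = hH.branch r R n :=
  (exists_branch hH r R n).choose_spec

theorem lev_branch (R : H.Ray) (n : ℕ) : hH.lev r (hH.branch r R n) = n := by
  obtain ⟨N, hN⟩ := branch_spec (hH := hH) (r := r) R n
  obtain ⟨h₁, h₂⟩ := hN N le_rfl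
  rw [← h₂, lev_anc h₁]

theorem anc_branch (R : H.Ray) {m n : ℕ} (h : m ≤ n) :
    hH.anc r (hH.branch r R n) m = hH.branch r R m := by
  obtain ⟨N, hN⟩ := branch_spec (hH := hH) (r := r) R n
  obtain ⟨M, hM⟩ := branch_spec (hH := hH) (r := r) R m
  rw [← (hN _ (le_max_left N M)).2, anc_anc h, (hM _ (le_max_right N M)).2]

/-- Two rays whose branches agree up to level `n` are not separated by vertices of levels below
`n`. -/
theorem exists_hasTailIn_of_branch_eq {R S : H.Ray} {n : ℕ}
    (h : hH.branch r R n = hH.branch r S n) {Y : Finset W} (hY : ∀ y ∈ Y, hH.lev r y < n) :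
    ∃ C : H.ComponentCompl (Y : Set W), R.HasTailIn C ∧ S.HasTailIn C := by
  have hYc : ∀ w, n ≤ hH.lev r w → w ∈ (Y : Set W)ᶜ := fun w hw hwY =>
    absurd (hY w hwY) (by omega)
  have ht := hYc _ (lev_branch (hH := hH) (r := r) R n).ge
  have key : ∀ Q : H.Ray, hH.branch r Q n = hH.branch r R n →
      Q.HasTailIn (H.componentComplMk ht) := by
    intro Q hQ
    obtain ⟨N, hN⟩ := branch_spec (hH := hH) (r := r) Q n
    refine ⟨N, fun m hm => ComponentCompl.mem_of_reachIn (H.componentComplMk_mem ht) ?_⟩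
    rw [← hQ, ← (hN m hm).2]
    exact reachIn_anc (hN m hm).1 hYc
  exact ⟨_, key R rfl, key S h.symm⟩

theorem equivalent_of_branch_eq {R S : H.Ray} (h : hH.branch r R = hH.branch r S) :
    R.Equivalent S := by
  refine Ray.equivalent_of_forall fun Y => ?_
  refine exists_hasTailIn_of_branch_eq (n := Y.sup (hH.lev r) + 1) (congrFun h _) fun y hy => ?_
  exact Nat.lt_succ_of_le (Finset.le_sup hy)

end IsTree

/-! ### Ends of normal trees, and the ultrametric they induce -/

namespace Subgraph

variable {T : G.Subgraph} {r : T.verts}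

theorem treeLE_iff (hT : T.coe.IsTree) {u v : T.verts} :
    T.TreeLE r u v ↔ ∃ n ≤ hT.lev r v, hT.anc r v n = u := by
  rw [← IsTree.mem_support_rootPath]
  exact ⟨fun ⟨p, hp, hu⟩ => IsTree.eq_rootPath (hH := hT) hp ▸ hu,
    fun hu => ⟨_, IsTree.isPath_rootPath v, hu⟩⟩

/-- Finitely many vertices that do not separate two rays in the subgraph `H` do not separate them
in `G`. -/
theorem exists_hasTailIn_inclRay (H : G.Subgraph) {R S : H.coe.Ray} {X : Finset V}
    {Y : Finset H.verts} (hXY : ∀ v : H.verts, (v : V) ∈ X → v ∈ Y)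
    (h : ∃ D : H.coe.ComponentCompl (Y : Set H.verts), R.HasTailIn D ∧ S.HasTailIn D) :
    ∃ C : G.ComponentCompl (X : Set V), (H.inclRay R).HasTailIn C ∧ (H.inclRay S).HasTailIn C := by
  obtain ⟨D, ⟨M, hM⟩, N, hN⟩ := h
  have hY : Set.MapsTo H.hom (Y : Set H.verts)ᶜ (X : Set V)ᶜ := fun v hv hX => hv (hXY v hX)
  have key : ∀ v : H.verts, v ∈ D → (v : V) ∈
      (D.map (induceHom H.hom hY) : G.ComponentCompl (X : Set V)) := by
    rintro v ⟨hv, rfl⟩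
    exact ⟨hY hv, rfl⟩
  exact ⟨_, ⟨M, fun n hn => key _ (hM n hn)⟩, N, fun n hn => key _ (hN n hn)⟩

namespace IsNormalTree

variable (hT : T.IsNormalTree r)
include hT

/-- In a normal tree, the vertices of level less than `n` below a vertex `t` of level `n` separate
the vertices above `t` from all other vertices of the tree. -/
theorem anc_eq_of_reachIn {t v w : T.verts} {n : ℕ} (hn : n ≤ hT.1.lev r w)
    (ht : hT.1.anc r w n = t) {A : Set V} (hA : ∀ i < n, (hT.1.anc r t i : V) ∈ A)
    (h : G.ReachIn Aᶜ (w : V) (v : V)) : n ≤ hT.1.lev r v ∧ hT.1.anc r v n = t := by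
  classical
  obtain ⟨p, hp⟩ := h
  -- Follow the walk from its last vertex `w` in `T`; the walk `q` is the part traversed since.
  suffices ∀ (z v' : V) (p : G.Walk z v'), (∀ x ∈ p.support, x ∈ Aᶜ) → v' = v →
      ∀ (w : T.verts) (q : G.Walk (w : V) z), n ≤ hT.1.lev r w → hT.1.anc r w n = t →
        (∀ x ∈ q.support, x ∈ T.verts → x = w) → n ≤ hT.1.lev r v ∧ hT.1.anc r v n = t from
    this w v p hp rfl w Walk.nil hn ht (by simp)
  clear hp p hn ht w
  intro z v' p
  induction p with
  | nil =>
    rintro - rfl w q hn ht hq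
    obtain rfl : v = w := Subtype.ext (hq _ q.end_mem_support v.2)
    exact ⟨hn, ht⟩
  | @cons z z' _ hadj p ih =>
    intro hp hv' w q hn ht hq
    simp only [Walk.support_cons, List.mem_cons, forall_eq_or_imp] at hp
    have hsupp : ∀ x ∈ (q.concat hadj).support, x ∈ T.verts → x = w ∨ x = z' := by
      intro x hx hxT
      rw [Walk.support_concat, List.mem_append, List.mem_singleton] at hx
      exact hx.imp_left (hq x · hxT)
    by_cases hz' : z' ∈ T.verts
    · suffices n ≤ hT.1.lev r ⟨z', hz'⟩ ∧ hT.1.anc r ⟨z', hz'⟩ n = t from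
        ih hp.2 hv' ⟨z', hz'⟩ Walk.nil this.1 this.2 (by simp)
      by_cases hne : (w : V) = z'
      · subst hne
        exact ⟨hn, ht⟩
      have hpath : T.IsHPath ((q.concat hadj).bypass) := by
        refine ⟨Walk.bypass_isPath _, hne, fun x => ⟨fun hx => ?_, ?_⟩⟩
        · exact hsupp x (Walk.support_bypass_subset_support _ hx.1) hx.2
        · rintro (rfl | rfl)
          · exact ⟨Walk.start_mem_support _, w.2⟩
          · exact ⟨Walk.end_mem_support _, hz'⟩
      rcases hT.2 w ⟨z', hz'⟩ _ hpath with h | h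
      · obtain ⟨k, hk, rfl⟩ := (treeLE_iff hT.1).1 h
        rw [IsTree.lev_anc hk] at hn
        rw [IsTree.anc_anc hn] at ht
        exact ⟨hn.trans hk, ht⟩
      · obtain ⟨k, hk, hz⟩ := (treeLE_iff hT.1).1 h
        -- An ancestor of `w` below `t` would lie in `A`.
        have hnk : n ≤ k := by
          by_contra hnk
          refine hp.2 z' p.start_mem_support ?_
          have := hA k (by omega)
          rwa [← ht, IsTree.anc_anc (by omega), hz] at this
        rw [← hz, IsTree.lev_anc hk, IsTree.anc_anc hnk]
        exact ⟨hnk, ht⟩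
    · refine ih hp.2 hv' w (q.concat hadj) hn ht fun x hx hxT => (hsupp x hx hxT).resolve_right ?_
      rintro rfl
      exact hz' hxT

/-- Given a ray `R` of a normal tree, finitely many vertices `A` determine the vertex of level `n`
on the branch of every ray that has a tail in the same component of `G - A` as `R`. -/
theorem exists_finset_branch_eq (R : T.coe.Ray) (n : ℕ) :
    ∃ A : Finset V, ∀ (S : T.coe.Ray) (C : G.ComponentCompl (A : Set V)),
      (T.inclRay R).HasTailIn C → (T.inclRay S).HasTailIn C →
        hT.1.branch r S n = hT.1.branch r R n := by
  classical
  let a : ℕ → V := fun i => hT.1.branch r R i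
  refine ⟨(Finset.range n).image a, ?_⟩
  rintro S C ⟨M, hM⟩ ⟨N, hN⟩
  obtain ⟨M', hM'⟩ := IsTree.branch_spec (hH := hT.1) (r := r) R n
  obtain ⟨N', hN'⟩ := IsTree.branch_spec (hH := hT.1) (r := r) S n
  obtain ⟨m, h₁, h₂, h₃, h₄⟩ : ∃ m, M ≤ m ∧ N ≤ m ∧ M' ≤ m ∧ N' ≤ m :=
    ⟨M + N + M' + N', by omega⟩
  have hA : ∀ i < n, (hT.1.anc r (hT.1.branch r R n) i : V) ∈
      (((Finset.range n).image a : Finset V) : Set V) := by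
    intro i hi
    rw [IsTree.anc_branch R hi.le]
    simpa using ⟨i, hi, rfl⟩
  rw [← (hN' m h₄).2]
  exact (hT.anc_eq_of_reachIn (hM' m h₃).1 (hM' m h₃).2 hA
    (ComponentCompl.reachIn (hM m h₁) (hN m h₂))).2

theorem injective_inclEnd : Function.Injective T.inclEnd := by
  intro ω η
  induction ω using Quotient.inductionOn with | _ R
  induction η using Quotient.inductionOn with | _ S
  intro h
  have h : (T.inclRay R).Equivalent (T.inclRay S) := Quotient.exact h
  have hb : hT.1.branch r S = hT.1.branch r R := by
    funext n
    obtain ⟨A, hA⟩ := hT.exists_finset_branch_eq R n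
    obtain ⟨C, hC⟩ := (T.inclRay R).exists_hasTailIn A
    exact hA S C hC (h.hasTailIn hC)
  exact (Quotient.sound (IsTree.equivalent_of_branch_eq hb)).symm

/-- If a normal tree contains a ray of every end, its branches embed the end space into a countable
product of discrete spaces, on which the first difference of two sequences defines an
ultrametric. -/
theorem isUltrametrizable (hsurj : Function.Surjective T.inclEnd) :
    IsUltrametrizable G.EndSpace := by
  classical
  have hray : ∀ ω : G.EndSpace, ∃ R : T.coe.Ray, Quotient.mk G.raySetoid (T.inclRay R) = ω := by
    intro ω
    obtain ⟨η, hη⟩ := hsurj ω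
    induction η using Quotient.inductionOn with | _ R
    exact ⟨R, hη⟩
  choose ray hray using hray
  let f : G.EndSpace → ℕ → T.verts := fun ω => hT.1.branch r (ray ω)
  -- Ends on a common branch up to a level above all vertices of `X` are not separated by `X`.
  have hfX : ∀ X : Finset V, ∃ n, ∀ ω η, f ω n = f η n →
      EndSpace.component X ω = EndSpace.component X η := by
    intro X
    let Y : Finset T.verts := X.preimage Subtype.val Subtype.val_injective.injOn
    refine ⟨Y.sup (hT.1.lev r) + 1, fun ω η h => ?_⟩
    obtain ⟨C, hC, hC'⟩ := T.exists_hasTailIn_inclRay (X := X) (Y := Y) (by simp [Y])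
      (IsTree.exists_hasTailIn_of_branch_eq h fun y hy => Nat.lt_succ_of_le (Finset.le_sup hy))
    rw [← hray ω, ← hray η, EndSpace.component_mk_eq_iff.2 hC, EndSpace.component_mk_eq_iff.2 hC']
  have hinj : Function.Injective f := fun ω η h => EndSpace.eq_of_forall_component fun X =>
    let ⟨n, hn⟩ := hfX X
    hn ω η (congrFun h n)
  let _ : TopologicalSpace T.verts := ⊥
  have : DiscreteTopology T.verts := ⟨rfl⟩
  have htop : (inferInstance : TopologicalSpace G.EndSpace) =
      TopologicalSpace.induced f inferInstance := by
    refine le_antisymm ?_ (le_generateFrom ?_)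
    · rw [← continuous_iff_le_induced]
      refine continuous_pi fun n => continuous_discrete_rng.2 fun t => ?_
      refine isOpen_iff_forall_mem_open.2 fun ω hω => ?_
      obtain ⟨A, hA⟩ := hT.exists_finset_branch_eq (ray ω) n
      refine ⟨_, fun η hη => ?_, EndSpace.isOpen_basicOpen A (EndSpace.component A ω), rfl⟩
      have hω' := EndSpace.hasTailIn_component A (T.inclRay (ray ω))
      have hη' := EndSpace.hasTailIn_component A (T.inclRay (ray η))
      have hη : EndSpace.component A η = EndSpace.component A ω := hη
      rw [hray] at hω' hη'
      rw [hη] at hη'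
      exact (hA _ _ hω' hη').trans hω
    · rintro _ ⟨X, C, rfl⟩
      obtain ⟨n, hn⟩ := hfX X
      refine ⟨(fun x : ℕ → T.verts => x n) ⁻¹' {t | ∃ ω ∈ EndSpace.basicOpen X C, f ω n = t},
        (isOpen_discrete _).preimage (continuous_apply n), ?_⟩
      ext η
      refine ⟨fun ⟨ω, hω, h⟩ => ?_, fun h => ⟨η, h, rfl⟩⟩
      exact (hn _ _ h).symm.trans hω
  let m : MetricSpace (ℕ → T.verts) := PiNat.metricSpace
  refine ⟨MetricSpace.induced f hinj m, htop.symm, ?_⟩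
  let _ := MetricSpace.induced f hinj m
  exact ⟨fun x y z => PiNat.dist_triangle_nonarch (f x) (f y) (f z)⟩

end IsNormalTree

end Subgraph

/-! ### Normal trees that contain a ray of every end -/

namespace Subgraph

variable {T : G.Subgraph} {r : T.verts}

theorem reachIn_of_coe (H : G.Subgraph) {S : Set H.verts} {S' : Set V} {u v : H.verts}
    (hS : ∀ w ∈ S, (w : V) ∈ S') (h : H.coe.ReachIn S u v) : G.ReachIn S' (u : V) (v : V) := by
  obtain ⟨p, hp⟩ := h
  refine ⟨p.map H.hom, fun w hw => ?_⟩
  obtain ⟨x, hx, rfl⟩ := List.mem_map.1 ((Walk.support_map _ p) ▸ hw)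
  exact hS x (hp x hx)

namespace IsNormalTree

variable (hT : T.IsNormalTree r)
include hT

/-- If no finite set of vertices separates the ray `R` from a normal tree, then the tree has, for
every `n`, a vertex `t` of level `n` such that all vertices of the tree near the end of `R` lie
above `t`. -/
theorem exists_vertex_below_end {R : G.Ray} (hcl : ∀ (X : Finset V)
    (C : G.ComponentCompl (X : Set V)), R.HasTailIn C → ∃ v : T.verts, (v : V) ∈ C) (n : ℕ) :
    ∃ (t : T.verts) (X : Finset V) (C : G.ComponentCompl (X : Set V)), R.HasTailIn C ∧
      ∀ v : T.verts, (v : V) ∈ C → n ≤ hT.1.lev r v ∧ hT.1.anc r v n = t := by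
  classical
  induction n with
  | zero =>
    obtain ⟨C, hC⟩ := R.exists_hasTailIn ∅
    exact ⟨r, ∅, C, hC, by simp⟩
  | succ n ih =>
    obtain ⟨t, X, C, hC, ht⟩ := ih
    let a : ℕ → V := fun i => hT.1.anc r t i
    let Y : Finset V := X ∪ (Finset.range (n + 1)).image a
    have hY : ∀ i < n + 1, (hT.1.anc r t i : V) ∈ (Y : Set V) := fun i hi =>
      Finset.mem_coe.2 (Finset.mem_union_right _
        (Finset.mem_image.2 ⟨i, Finset.mem_range.2 hi, rfl⟩))
    obtain ⟨D, hD⟩ := R.exists_hasTailIn Y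
    obtain ⟨v, hv⟩ := hcl Y D hD
    obtain ⟨hn, hvt⟩ := ht v (hC.mem_mono Finset.subset_union_left hD hv)
    have hn' : n + 1 ≤ hT.1.lev r v := by
      by_contra h
      rw [IsTree.anc_of_lev_le (by omega)] at hvt
      refine ComponentCompl.notMem_of_mem hv ?_
      have := hY n (by omega)
      rwa [← hvt, IsTree.anc_of_lev_le (by omega)] at this
    refine ⟨hT.1.anc r v (n + 1), Y, D, hD, fun w hw => ?_⟩
    refine hT.anc_eq_of_reachIn hn' rfl (A := Y) (fun i hi => ?_) (ComponentCompl.reachIn hv hw)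
    have := hY i hi
    rwa [← hvt, IsTree.anc_anc (by omega), ← IsTree.anc_anc (r := r) hi.le] at this

/-- A normal tree that no finite set of vertices separates from any end contains a ray of every
end. -/
theorem surjective_inclEnd (hcl : ∀ (R : G.Ray) (X : Finset V)
    (C : G.ComponentCompl (X : Set V)), R.HasTailIn C → ∃ v : T.verts, (v : V) ∈ C) :
    Function.Surjective T.inclEnd := by
  classical
  intro ω
  induction ω using Quotient.inductionOn with | _ R
  choose t Z D hD ht using hT.exists_vertex_below_end (hcl R)
  -- Near the end of `R` there is a vertex of the tree above both `t m` and `t n`.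
  have hcommon : ∀ (m n : ℕ) (X : Finset V) (C : G.ComponentCompl (X : Set V)), R.HasTailIn C →
      ∃ v : T.verts, (v : V) ∈ C ∧ (m ≤ hT.1.lev r v ∧ hT.1.anc r v m = t m) ∧
        n ≤ hT.1.lev r v ∧ hT.1.anc r v n = t n := by
    intro m n X C hC
    obtain ⟨E, hE⟩ := R.exists_hasTailIn (X ∪ (Z m ∪ Z n))
    obtain ⟨v, hv⟩ := hcl R _ E hE
    refine ⟨v, hC.mem_mono Finset.subset_union_left hE hv, ht m v ?_, ht n v ?_⟩
    · exact (hD m).mem_mono (Finset.subset_union_left.trans Finset.subset_union_right) hE hv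
    · exact (hD n).mem_mono (Finset.subset_union_right.trans Finset.subset_union_right) hE hv
  have hlev : ∀ n, hT.1.lev r (t n) = n := by
    intro n
    obtain ⟨v, -, ⟨h, h'⟩, -⟩ := hcommon n n _ _ (hD n)
    rw [← h', IsTree.lev_anc h]
  let S : T.coe.Ray :=
    { toFun := t
      injective := fun m n h => by rw [← hlev m, h, hlev n]
      adj := fun n => by
        obtain ⟨v, -, ⟨_, h⟩, h', h''⟩ := hcommon n (n + 1) _ _ (hD n)
        rw [← h, ← h'']
        exact IsTree.adj_anc h' }
  refine ⟨Quotient.mk T.coe.raySetoid S, ?_⟩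
  refine (Quotient.sound ?_ : Quotient.mk G.raySetoid (T.inclRay S) = Quotient.mk G.raySetoid R)
  refine Ray.equivalent_of_forall fun X => ?_
  obtain ⟨C, hC⟩ := R.exists_hasTailIn X
  let Y : Finset T.verts := X.preimage Subtype.val Subtype.val_injective.injOn
  let n := Y.sup (hT.1.lev r) + 1
  have hreach : ∀ v : T.verts, n ≤ hT.1.lev r v → hT.1.anc r v n = t n →
      G.ReachIn (X : Set V)ᶜ (t n : V) (v : V) := by
    intro v hv hvn
    rw [← hvn]
    refine T.reachIn_of_coe (S := {w | n ≤ hT.1.lev r w}) (fun w hw hwX => ?_)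
      (IsTree.reachIn_anc hv fun w hw => hw)
    have : hT.1.lev r w ≤ Y.sup (hT.1.lev r) :=
      Finset.le_sup (f := hT.1.lev r) (by simpa [Y] using hwX)
    have : n ≤ hT.1.lev r w := hw
    omega
  refine ⟨C, ⟨n, fun m hm => ?_⟩, hC⟩
  obtain ⟨v, hv, ⟨_, h⟩, h', h''⟩ := hcommon m n X C hC
  refine ComponentCompl.mem_of_reachIn hv ((hreach v h' h'').symm.trans (hreach (t m) ?_ ?_))
  · rwa [hlev]
  · rw [← h, IsTree.anc_anc hm, h'']

end IsNormalTree

end Subgraph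

/-! ### Search trees -/

section Acyclic

variable {W : Type*} {H : SimpleGraph W}

/-- A graph is acyclic if its vertices have heights such that adjacent vertices have distinct
heights and every vertex has at most one lower neighbour: a highest vertex of a cycle would have
two. -/
theorem isAcyclic_of_height (h : W → ℕ) (hne : ∀ u v, H.Adj u v → h u ≠ h v)
    (huniq : ∀ u v w, H.Adj u v → H.Adj u w → h v < h u → h w < h u → v = w) : H.IsAcyclic := by
  classical
  intro v c hc
  obtain ⟨u, hu, hmax⟩ := c.support.toFinset.exists_max_image h ⟨v, by simp⟩
  rw [List.mem_toFinset] at hu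
  have hc' := hc.rotate hu
  have hlt : ∀ w ∈ (c.rotate u hu).support, H.Adj u w → h w < h u := by
    intro w hw hadj
    have hw' : w ∈ c.support := (Walk.mem_support_rotate_iff c u hu).1 hw
    exact lt_of_le_of_ne (hmax w (List.mem_toFinset.2 hw')) (hne _ _ hadj).symm
  have h₁ := Walk.adj_snd hc'.not_nil
  have h₂ := (Walk.adj_penultimate hc'.not_nil).symm
  exact hc'.snd_ne_penultimate (huniq _ _ _ h₁ h₂ (hlt _ (Walk.getVert_mem_support _ _) h₁)
    (hlt _ (Walk.getVert_mem_support _ _) h₂))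

end Acyclic

section Search

variable (G) (r : V) (f : V → Set V → V)

/-- The depth-first search for the vertex `u`, started at `r` and guided by `f`. Its step `n` is a
pair `(D, x)`: a connected set `D` of unvisited vertices, containing `u`, and the vertex `x` of `D`
visited next. The next set is the component of `D - x` that contains `u`, and
`f` selects in it a neighbour of `x`. Once `u` has been visited, the sets are empty and the vertices
have no meaning. -/
def search (u : V) : ℕ → Set V × V
  | 0 => (Set.univ, r)
  | n + 1 =>
    let D := {v | G.ReachIn ((search u n).1 \ {(search u n).2}) u v}
    (D, f (search u n).2 D)

/-- The set of unvisited vertices at step `n` of the search for `u`. -/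
def searchSet (u : V) (n : ℕ) : Set V := (search G r f u n).1

/-- The vertex visited at step `n` of the search for `u`. -/
def searchVert (u : V) (n : ℕ) : V := (search G r f u n).2

/-- The search for `u` visits `u` at step `n`. -/
def IsNode (u : V) (n : ℕ) : Prop := u ∈ searchSet G r f u n ∧ searchVert G r f u n = u

variable {G r f} {u v : V} {m n : ℕ}

local notation "𝒟" => searchSet G r f
local notation "𝓍" => searchVert G r f

theorem searchSet_succ : 𝒟 u (n + 1) = {v | G.ReachIn (𝒟 u n \ {𝓍 u n}) u v} := rfl

theorem searchVert_succ : 𝓍 u (n + 1) = f (𝓍 u n) (𝒟 u (n + 1)) := rfl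

theorem searchSet_succ_subset : 𝒟 u (n + 1) ⊆ 𝒟 u n \ {𝓍 u n} := fun _ h => ReachIn.mem_right h

theorem searchSet_anti (h : m ≤ n) : 𝒟 u n ⊆ 𝒟 u m := by
  induction n, h using Nat.le_induction with
  | base => exact subset_rfl
  | succ n _ ih => exact (searchSet_succ_subset.trans Set.sdiff_subset).trans ih

theorem search_eq (h : v ∈ 𝒟 u n) : 𝒟 v n = 𝒟 u n ∧ 𝓍 v n = 𝓍 u n := by
  induction n with
  | zero => exact ⟨rfl, rfl⟩
  | succ n ih =>
    obtain ⟨h₁, h₂⟩ := ih (searchSet_anti n.le_succ h)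
    have hD : 𝒟 v (n + 1) = 𝒟 u (n + 1) := by
      rw [searchSet_succ, searchSet_succ, h₁, h₂]
      rw [searchSet_succ] at h
      ext w
      exact ⟨fun hw => ReachIn.trans h hw, fun hw => (ReachIn.symm h).trans hw⟩
    exact ⟨hD, by rw [searchVert_succ, searchVert_succ, hD, h₂]⟩

theorem search_eq_of_le (hmn : m ≤ n) (h : v ∈ 𝒟 u n) : 𝒟 v m = 𝒟 u m ∧ 𝓍 v m = 𝓍 u m :=
  search_eq (searchSet_anti hmn h)

theorem self_mem_searchSet (h : v ∈ 𝒟 u n) : v ∈ 𝒟 v n := by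
  rwa [(search_eq h).1]

theorem self_mem_searchSet_succ (h : u ∈ 𝒟 u n) (hne : 𝓍 u n ≠ u) : u ∈ 𝒟 u (n + 1) :=
  ReachIn.refl ⟨h, fun h => hne h.symm⟩

theorem IsNode.mem_searchSet_iff (h : IsNode G r f u n) : u ∈ 𝒟 u m ↔ m ≤ n := by
  refine ⟨fun hm => ?_, fun hm => searchSet_anti hm h.1⟩
  by_contra hlt
  exact (searchSet_succ_subset (searchSet_anti (by omega : n + 1 ≤ m) hm)).2 h.2.symm

theorem IsNode.unique (hm : IsNode G r f u m) (hn : IsNode G r f u n) : m = n :=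
  le_antisymm (hn.mem_searchSet_iff.1 hm.1) (hm.mem_searchSet_iff.1 hn.1)

/-- A vertex that the search never finds stays in all sets of unvisited vertices. -/
theorem mem_searchSet_of_not_isNode (h : ∀ n, ¬ IsNode G r f u n) (n : ℕ) : u ∈ 𝒟 u n := by
  induction n with
  | zero => trivial
  | succ n ih => exact self_mem_searchSet_succ ih fun hx => h n ⟨ih, hx⟩

variable (hG : G.Connected)
  (hf : ∀ y S, (∃ z ∈ S, G.Adj y z) → f y S ∈ S ∧ G.Adj y (f y S))

include hG in
theorem reachIn_searchSet {a b : V} (ha : a ∈ 𝒟 u n) (hb : b ∈ 𝒟 u n) :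
    G.ReachIn (𝒟 u n) a b := by
  cases n with
  | zero =>
    obtain ⟨p⟩ := hG.preconnected a b
    exact ⟨p, fun _ _ => trivial⟩
  | succ n => exact (ReachIn.restrict ha).symm.trans (ReachIn.restrict hb)

include hG hf

theorem searchVert_succ_mem (hx : 𝓍 u n ∈ 𝒟 u n) (hu : u ∈ 𝒟 u (n + 1)) :
    𝓍 u (n + 1) ∈ 𝒟 u (n + 1) ∧ G.Adj (𝓍 u n) (𝓍 u (n + 1)) := by
  have hu' := searchSet_succ_subset hu
  obtain ⟨y, hy, hadj⟩ := (reachIn_searchSet hG hu'.1 hx).exists_adj_end hu'.2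
  exact hf _ _ ⟨y, hy, hadj⟩

theorem searchVert_mem (h : u ∈ 𝒟 u n) : 𝓍 u n ∈ 𝒟 u n := by
  induction n with
  | zero => trivial
  | succ n ih => exact (searchVert_succ_mem hG hf (ih (searchSet_anti n.le_succ h)) h).1

theorem adj_searchVert (h : u ∈ 𝒟 u (n + 1)) : G.Adj (𝓍 u n) (𝓍 u (n + 1)) :=
  (searchVert_succ_mem hG hf (searchVert_mem hG hf (searchSet_anti n.le_succ h)) h).2

/-- All vertices visited in the search for `u` are found by their own search. -/
theorem isNode_searchVert (h : u ∈ 𝒟 u n) : IsNode G r f (𝓍 u n) n := by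
  have hx := searchVert_mem hG hf h
  exact ⟨self_mem_searchSet hx, (search_eq hx).2⟩


omit hG hf in
/-- A walk starting at `u` that avoids the first `n` vertices visited in the search for `u` stays
in the set of unvisited vertices. -/
theorem mem_searchSet_of_reachIn {S : Set V} (h : G.ReachIn S u v)
    (hS : ∀ i < n, 𝓍 u i ∉ S) : v ∈ 𝒟 u n := by
  induction n generalizing v with
  | zero => trivial
  | succ n ih =>
    refine h.restrict.mono fun w hw => ⟨ih hw fun i hi => hS i (by omega), ?_⟩
    rintro rfl
    exact hS n n.lt_succ_self (ReachIn.mem_right hw)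

/-- The part of the search for a node `a` from step `n` on is a walk through nodes that their own
searches visit at step `n` or later. -/
theorem reachIn_searchVert {a : V} {k : ℕ} (ha : IsNode G r f a k) (hnk : n ≤ k) {S : Set V}
    (hS : ∀ v l, n ≤ l → IsNode G r f v l → v ∈ S) : G.ReachIn S (𝓍 a n) a := by
  suffices ∀ l, n ≤ l → l ≤ k → G.ReachIn S (𝓍 a n) (𝓍 a l) by
    simpa only [ha.2] using this k hnk le_rfl
  have hmem : ∀ l, n ≤ l → l ≤ k → 𝓍 a l ∈ S := fun l hnl hlk =>
    hS _ l hnl (isNode_searchVert hG hf (ha.mem_searchSet_iff.2 hlk))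
  intro l hnl
  induction l, hnl using Nat.le_induction with
  | base => exact fun h => .refl (hmem n le_rfl h)
  | succ l hnl ih =>
    intro h
    exact (ih (by omega)).trans (.of_adj (adj_searchVert hG hf (ha.mem_searchSet_iff.2 h))
      (hmem l hnl (by omega)) (hmem _ (by omega) h))

variable (r) in
/-- The tree formed by the vertices that the search finds; the parent of a vertex is the vertex
visited before it. -/
def searchTree : G.Subgraph where
  verts := {u | ∃ n, IsNode G r f u n}
  Adj u v := ∃ n, (IsNode G r f v (n + 1) ∧ 𝓍 v n = u) ∨ (IsNode G r f u (n + 1) ∧ 𝓍 u n = v)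
  adj_sub := by
    have key : ∀ {u n}, IsNode G r f u (n + 1) → G.Adj (𝓍 u n) u := fun h => by
      simpa only [h.2] using adj_searchVert hG hf h.1
    rintro u v ⟨n, ⟨h, rfl⟩ | ⟨h, rfl⟩⟩
    exacts [key h, (key h).symm]
  edge_vert := by
    rintro u v ⟨n, ⟨h, rfl⟩ | ⟨h, rfl⟩⟩
    · exact ⟨n, isNode_searchVert hG hf (searchSet_anti n.le_succ h.1)⟩
    · exact ⟨n + 1, h⟩
  symm := ⟨fun _ _ ⟨n, h⟩ => ⟨n, h.symm⟩⟩

local notation "𝒯" => searchTree r hG hf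

variable (r) in
/-- The root of the search tree. -/
def searchRoot : (searchTree r hG hf).verts :=
  ⟨r, 0, trivial, rfl⟩

theorem exists_path_searchTree (v : (𝒯).verts) (hv : IsNode G r f (v : V) n) :
    ∃ p : (𝒯).coe.Walk (searchRoot r hG hf) v, p.IsPath ∧
      ∀ w, w ∈ p.support ↔ ∃ i ≤ n, 𝓍 (v : V) i = w := by
  induction n generalizing v with
  | zero =>
    obtain rfl : searchRoot r hG hf = v := Subtype.ext hv.2
    refine ⟨Walk.nil, Walk.IsPath.nil, fun w => ?_⟩
    simp only [Walk.support_nil, List.mem_singleton, Nat.le_zero, exists_eq_left]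
    exact ⟨fun h => (congrArg Subtype.val h).symm, fun h => Subtype.ext h.symm⟩
  | succ n ih =>
    have hv' : (v : V) ∈ 𝒟 (v : V) n := searchSet_anti n.le_succ hv.1
    have hu := isNode_searchVert hG hf hv'
    obtain ⟨p, hp, hsupp⟩ := ih ⟨𝓍 (v : V) n, n, hu⟩ hu
    have hanc : ∀ i ≤ n, 𝓍 (𝓍 (v : V) n) i = 𝓍 (v : V) i := fun i hi =>
      (search_eq_of_le hi (searchVert_mem hG hf hv')).2
    have hadj : (𝒯).coe.Adj ⟨𝓍 (v : V) n, n, hu⟩ v := ⟨n, Or.inl ⟨hv, rfl⟩⟩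
    refine ⟨p.concat hadj, hp.concat (fun hvp => ?_) hadj, fun w => ?_⟩
    · obtain ⟨i, hi, h⟩ := (hsupp v).1 hvp
      rw [hanc i hi] at h
      have := isNode_searchVert hG hf (searchSet_anti hi hv')
      rw [h] at this
      have := this.unique hv
      omega
    · rw [Walk.support_concat, List.mem_append, List.mem_singleton, hsupp]
      constructor
      · rintro (⟨i, hi, h⟩ | rfl)
        · exact ⟨i, by omega, by rw [← h, hanc i hi]⟩
        · exact ⟨n + 1, le_rfl, hv.2⟩
      · rintro ⟨i, hi, h⟩
        rcases Nat.le_succ_iff.1 hi with hi | rfl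
        · exact Or.inl ⟨i, hi, by rw [← h, hanc i hi]⟩
        · exact Or.inr (Subtype.ext (h.symm.trans hv.2))

theorem isTree_searchTree : (𝒯).coe.IsTree := by
  refine ⟨(connected_iff _).2 ⟨fun u v => ?_, ⟨searchRoot r hG hf⟩⟩, ?_⟩
  · obtain ⟨m, hm⟩ := u.2
    obtain ⟨n, hn⟩ := v.2
    obtain ⟨p, -⟩ := exists_path_searchTree hG hf u hm
    obtain ⟨q, -⟩ := exists_path_searchTree hG hf v hn
    exact ⟨p.reverse.append q⟩
  · have hparent : ∀ u v : (𝒯).verts, ∀ n, IsNode G r f (v : V) (n + 1) → 𝓍 (v : V) n = u →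
        u.2.choose + 1 = v.2.choose := by
      intro u v n hv hu
      have := isNode_searchVert hG hf (searchSet_anti n.le_succ hv.1)
      rw [hu] at this
      rw [u.2.choose_spec.unique this, v.2.choose_spec.unique hv]
    refine isAcyclic_of_height (fun v => v.2.choose) ?_ ?_
    · rintro u v ⟨n, ⟨h, h'⟩ | ⟨h, h'⟩⟩
      · have := hparent u v n h h'
        omega
      · have := hparent v u n h h'
        omega
    · rintro u v w ⟨m, ⟨h, h'⟩ | ⟨h, h'⟩⟩ ⟨n, ⟨k, k'⟩ | ⟨k, k'⟩⟩ hvu hwu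
      · have := hparent u v m h h'
        omega
      · have := hparent u v m h h'
        omega
      · have := hparent u w n k k'
        omega
      · obtain rfl : m = n := Nat.succ_injective (h.unique k)
        exact Subtype.ext (h'.symm.trans k')

theorem isNormalTree_searchTree : (𝒯).IsNormalTree (searchRoot r hG hf) := by
  have key : ∀ (u v : (𝒯).verts) (m n : ℕ), IsNode G r f (u : V) m → IsNode G r f (v : V) n →
      m ≤ n → ∀ p : G.Walk (u : V) (v : V), (𝒯).IsHPath p →
        (𝒯).TreeLE (searchRoot r hG hf) u v := by
    intro u v m n hu hv hmn p hp
    obtain ⟨q, hq, hsupp⟩ := exists_path_searchTree hG hf v hv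
    refine ⟨q, hq, (hsupp u).2 ⟨m, hmn, ?_⟩⟩
    -- The path avoids the vertices visited before `u`, so the search for `v` also visits `u`.
    have hvu : (v : V) ∈ 𝒟 (u : V) m := by
      refine mem_searchSet_of_reachIn (S := {w | w ∈ p.support}) ⟨p, fun w hw => hw⟩ ?_
      intro i hi hip
      have hnode := isNode_searchVert hG hf (hu.mem_searchSet_iff.2 hi.le)
      rcases (hp.2.2 _).1 ⟨hip, i, hnode⟩ with h | h <;> rw [h] at hnode
      · have := hnode.unique hu
        omega
      · have := hnode.unique hv
        omega
    exact (search_eq hvu).2.trans hu.2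
  refine ⟨isTree_searchTree hG hf, fun u v p hp => ?_⟩
  obtain ⟨m, hm⟩ := u.2
  obtain ⟨n, hn⟩ := v.2
  rcases le_total m n with h | h
  · exact Or.inl (key u v m n hm hn h p hp)
  · refine Or.inr (key v u n m hn hm h p.reverse ⟨hp.1.reverse, hp.2.1.symm, fun w => ?_⟩)
    rw [Walk.support_reverse, List.mem_reverse, hp.2.2 w, or_comm]

end Search

/-! ### Normal trees containing countably many dispersed sets -/

/-- A set `U` of vertices is dispersed if every end can be separated from it by a finite set of
vertices. -/
def IsDispersed (G : SimpleGraph V) (U : Set V) : Prop :=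
  ∀ R : G.Ray, ∃ (X : Finset V) (C : G.ComponentCompl (X : Set V)), R.HasTailIn C ∧ ∀ v ∈ C, v ∉ U

section Guide

variable (G) (U : ℕ → Set V)

/-- The least index of a set `U i` that meets `S`. -/
noncomputable def leastIndex (S : Set V) : ℕ := sInf {i | ∃ a ∈ S, a ∈ U i}

/-- The length of a shortest walk inside `S` from `y` to the set `U i` of least index among those
that meet `S`. -/
noncomputable def distToLeast (S : Set V) (y : V) : ℕ :=
  sInf {l | ∃ a ∈ U (leastIndex U S), ∃ p : G.Walk y a, p.length = l ∧ ∀ w ∈ p.support, w ∈ S}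

variable {G U}

theorem leastIndex_le {S : Set V} {a : V} {i : ℕ} (ha : a ∈ S) (hi : a ∈ U i) :
    leastIndex U S ≤ i :=
  Nat.sInf_le ⟨a, ha, hi⟩

theorem exists_mem_leastIndex {S : Set V} {a : V} {i : ℕ} (ha : a ∈ S) (hi : a ∈ U i) :
    ∃ b ∈ S, b ∈ U (leastIndex U S) :=
  Nat.sInf_mem (s := {i | ∃ a ∈ S, a ∈ U i}) ⟨i, a, ha, hi⟩

variable (G U) in
/-- There is a guide for the search which always selects a neighbour closest to the set `U i` of
least index among those that meet the set of unvisited vertices. -/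
theorem exists_guide : ∃ f : V → Set V → V, ∀ y S, (∃ z ∈ S, G.Adj y z) →
    (f y S ∈ S ∧ G.Adj y (f y S)) ∧
      ∀ z ∈ S, G.Adj y z → distToLeast G U S (f y S) ≤ distToLeast G U S z := by
  have : ∀ (y : V) (S : Set V), ∃ t, (∃ z ∈ S, G.Adj y z) → (t ∈ S ∧ G.Adj y t) ∧
      ∀ z ∈ S, G.Adj y z → distToLeast G U S t ≤ distToLeast G U S z := by
    intro y S
    by_cases h : ∃ z ∈ S, G.Adj y z
    · obtain ⟨t, ht, hmin⟩ := (measure (distToLeast G U S)).wf.has_min {z | z ∈ S ∧ G.Adj y z} h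
      exact ⟨t, fun _ => ⟨ht, fun z hz hyz => not_lt.1 (hmin z ⟨hz, hyz⟩)⟩⟩
    · exact ⟨y, fun h' => absurd h' h⟩
  choose f hf using this
  exact ⟨f, hf⟩

variable {r : V} {f : V → Set V → V} (hG : G.Connected)
  (hf : ∀ y S, (∃ z ∈ S, G.Adj y z) → (f y S ∈ S ∧ G.Adj y (f y S)) ∧
    ∀ z ∈ S, G.Adj y z → distToLeast G U S (f y S) ≤ distToLeast G U S z)
include hG hf

/-- Above every node `y` there is a node in the set `U i` of least index among those that meet the
set of vertices unvisited at `y`: from `y`, the guide leads along a shortest walk to `U i`. -/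
theorem exists_isNode_mem {n d : ℕ} {y a : V} (hy : IsNode G r f y n)
    (ha : a ∈ U (leastIndex U (searchSet G r f y n))) (p : G.Walk y a) (hpd : p.length ≤ d)
    (hp : ∀ w ∈ p.support, w ∈ searchSet G r f y n) :
    ∃ b ∈ searchSet G r f y n, b ∈ U (leastIndex U (searchSet G r f y n)) ∧
      ∃ k, IsNode G r f b k := by
  classical
  induction d generalizing n y a with
  | zero =>
    obtain rfl := Walk.eq_of_length_eq_zero (Nat.le_zero.1 hpd)
    exact ⟨y, hy.1, ha, n, hy⟩
  | succ d ih =>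
    have hpath := p.bypass_isPath
    have hlen := p.length_bypass_le_length.trans hpd
    have hsupp : ∀ w ∈ p.bypass.support, w ∈ searchSet G r f y n := fun w hw =>
      hp w (p.support_bypass_subset_support hw)
    generalize p.bypass = q at hpath hlen hsupp
    cases q with
    | nil => exact ⟨y, hy.1, ha, n, hy⟩
    | @cons _ z _ hadj q =>
      rw [Walk.cons_isPath_iff] at hpath
      simp only [Walk.support_cons, List.mem_cons, forall_eq_or_imp] at hsupp
      rw [Walk.length_cons] at hlen
      have hq : ∀ w ∈ q.support, w ∈ searchSet G r f y n \ {y} := by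
        refine fun w hw => ⟨hsupp.2 w hw, ?_⟩
        rintro rfl
        exact hpath.2 hw
      obtain ⟨hDz, hxz⟩ := search_eq (hsupp.2 z q.start_mem_support)
      rw [hy.2] at hxz
      set S := searchSet G r f z (n + 1) with hS
      have hSy : S ⊆ searchSet G r f y n :=
        (searchSet_succ_subset.trans Set.sdiff_subset).trans hDz.subset
      have hqS : ∀ w ∈ q.support, w ∈ S := by
        intro w hw
        rw [hS, searchSet_succ, hDz, hxz]
        exact ⟨q.takeUntil w hw, fun v hv => hq v (q.support_takeUntil_subset_support hw hv)⟩
      have hzS : z ∈ S := hqS z q.start_mem_support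
      have haS : a ∈ S := hqS a q.end_mem_support
      have hidx : leastIndex U S = leastIndex U (searchSet G r f y n) := by
        refine le_antisymm (leastIndex_le haS ha) ?_
        obtain ⟨b, hb, hb'⟩ := exists_mem_leastIndex haS ha
        exact leastIndex_le (hSy hb) hb'
      obtain ⟨⟨htS, -⟩, hmin⟩ := hf y S ⟨z, hzS, hadj⟩
      have hx : searchVert G r f z (n + 1) = f y S := by rw [searchVert_succ, hxz]
      have ht : IsNode G r f (f y S) (n + 1) :=
        hx ▸ isNode_searchVert hG (fun y S h => (hf y S h).1) hzS
      have hDt : searchSet G r f (f y S) (n + 1) = S := (search_eq htS).1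
      obtain ⟨b, hb, w, hw, hwS⟩ : distToLeast G U S (f y S) ∈ {l | ∃ a ∈ U (leastIndex U S),
          ∃ p : G.Walk (f y S) a, p.length = l ∧ ∀ w ∈ p.support, w ∈ S} := by
        obtain ⟨w, hw⟩ := reachIn_searchSet hG htS haS
        exact Nat.sInf_mem ⟨_, a, hidx ▸ ha, w, rfl, hw⟩
      have hd : w.length ≤ d := by
        rw [hw]
        refine (hmin z hzS hadj).trans (le_trans (Nat.sInf_le ?_) (Nat.le_of_succ_le_succ hlen))
        exact ⟨a, hidx ▸ ha, q, rfl, hqS⟩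
      rw [← hDt] at hb
      obtain ⟨c, hc, hcU, hck⟩ := ih ht hb w hd fun v hv => hDt.symm.subset (hwS v hv)
      rw [hDt] at hc hcU
      exact ⟨c, hSy hc, hidx ▸ hcU, hck⟩

/-- A search guided towards dispersed sets finds all their vertices. Otherwise the search for some
vertex would follow a ray with infinitely many nodes of one of the sets above it, and these cannot
be separated from the end of the ray. -/
theorem exists_isNode_of_isDispersed (hU : ∀ i, G.IsDispersed (U i)) {u : V} {i : ℕ}
    (hu : u ∈ U i) : ∃ n, IsNode G r f u n := by
  classical
  have hf' : ∀ y S, (∃ z ∈ S, G.Adj y z) → f y S ∈ S ∧ G.Adj y (f y S) := fun y S h => (hf y S h).1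
  by_contra hno
  push Not at hno
  have hmem := mem_searchSet_of_not_isNode hno
  have hnode : ∀ n, IsNode G r f (searchVert G r f u n) n := fun n =>
    isNode_searchVert hG hf' (hmem n)
  let S : G.Ray :=
    { toFun := searchVert G r f u
      injective := fun m n h =>
        (h ▸ hnode m : IsNode G r f (searchVert G r f u n) m).unique (hnode n)
      adj := fun n => adj_searchVert hG hf' (hmem (n + 1)) }
  -- The least index is nondecreasing and at most `i`; let `n₀` be a step where it is largest.
  have hbdd : BddAbove (Set.range fun n => leastIndex U (searchSet G r f u n)) :=
    ⟨i, by rintro _ ⟨n, rfl⟩; exact leastIndex_le (hmem n) hu⟩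
  obtain ⟨n₀, hn₀⟩ := Nat.sSup_mem (Set.range_nonempty _) hbdd
  have hidx : ∀ n, n₀ ≤ n →
      leastIndex U (searchSet G r f u n) = leastIndex U (searchSet G r f u n₀) := by
    intro n hn
    refine le_antisymm ((le_csSup hbdd ⟨n, rfl⟩).trans hn₀.ge) ?_
    obtain ⟨b, hb, hb'⟩ := exists_mem_leastIndex (hmem n) hu
    exact leastIndex_le (searchSet_anti hn hb) hb'
  obtain ⟨X, C, ⟨N, hN⟩, hCU⟩ := hU (leastIndex U (searchSet G r f u n₀)) S
  have hheight : ∀ v : V, ∃ B, ∀ k, IsNode G r f v k → k < B := by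
    intro v
    by_cases h : ∃ k, IsNode G r f v k
    · obtain ⟨k, hk⟩ := h
      exact ⟨k + 1, fun l hl => by rw [hl.unique hk]; omega⟩
    · exact ⟨0, fun k hk => absurd ⟨k, hk⟩ h⟩
  choose B hB using hheight
  obtain ⟨n, hn, hnN, hnX⟩ : ∃ n, n₀ ≤ n ∧ N ≤ n ∧ X.sup B ≤ n :=
    ⟨n₀ + N + X.sup B, by omega, by omega, by omega⟩
  have hDn' : searchSet G r f (searchVert G r f u n) n = searchSet G r f u n :=
    (search_eq (searchVert_mem hG hf' (hmem n))).1
  obtain ⟨a, ha, haU⟩ := exists_mem_leastIndex (hmem n) hu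
  obtain ⟨p, hp⟩ := reachIn_searchSet hG (searchVert_mem hG hf' (hmem n)) ha
  rw [← hDn'] at haU hp
  obtain ⟨b, hb, hbU, k, hbk⟩ := exists_isNode_mem hG hf (hnode n) haU p le_rfl hp
  rw [hDn'] at hb hbU
  rw [hidx n hn] at hbU
  have hnk : n ≤ k := hbk.mem_searchSet_iff.1 (self_mem_searchSet hb)
  have hreach : G.ReachIn (X : Set V)ᶜ (searchVert G r f b n) b := by
    refine reachIn_searchVert hG hf' hbk hnk fun v l hl hv hvX => ?_
    have h₁ := hB v l hv
    have h₂ : B v ≤ X.sup B := Finset.le_sup (f := B) hvX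
    omega
  rw [(search_eq hb).2] at hreach
  exact hCU b (ComponentCompl.mem_of_reachIn (hN n hnN) hreach) hbU

end Guide

/-- A countable union of dispersed sets is contained in a normal tree. -/
theorem exists_isNormalTree_of_isDispersed (hG : G.Connected) (U : ℕ → Set V)
    (hU : ∀ i, G.IsDispersed (U i)) :
    ∃ (T : G.Subgraph) (r : T.verts), T.IsNormalTree r ∧ ∀ i, U i ⊆ T.verts := by
  obtain ⟨f, hf⟩ := exists_guide G U
  obtain ⟨r⟩ := hG.nonempty
  exact ⟨_, _, isNormalTree_searchTree (r := r) hG fun y S h => (hf y S h).1,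
    fun i u hu => exists_isNode_of_isDispersed hG hf hU hu⟩

/-! ### Dispersed sets from disjoint rays -/

/-- A symmetric relation has a maximal set of pairwise related elements. -/
theorem exists_maximal_pairwise {α : Type*} (P : α → α → Prop) (hP : ∀ a b, P a b → P b a) :
    ∃ S : Set α, S.Pairwise P ∧ ∀ a, (∀ b ∈ S, P a b) → a ∈ S := by
  obtain ⟨S, hS⟩ := zorn_subset {S : Set α | S.Pairwise P} fun c hc hchain =>
    ⟨⋃₀ c, (Set.pairwise_sUnion hchain.directedOn).2 hc, fun s hs => Set.subset_sUnion_of_mem hs⟩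
  refine ⟨S, hS.1, fun a ha => ?_⟩
  have : insert a S ∈ {S : Set α | S.Pairwise P} :=
    hS.1.insert fun b hb _ => ⟨ha b hb, hP _ _ (ha b hb)⟩
  exact hS.2 this (Set.subset_insert a S) (Set.mem_insert a S)

/-- A ray with a vertex in the component `C` of `G - X` that has its tail in another component
meets `X`. -/
theorem Ray.exists_mem_of_hasTailIn_ne {R : G.Ray} {X : Finset V}
    {C D : G.ComponentCompl (X : Set V)} {m : ℕ} (hm : R.toFun m ∈ C) (hD : R.HasTailIn D)
    (hne : D ≠ C) : ∃ n, R.toFun n ∈ X := by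
  by_contra! h
  refine hne (hD.unique ⟨m, fun n hn => ?_⟩)
  induction n, hn using Nat.le_induction with
  | base => exact hm
  | succ n _ ih => exact ComponentCompl.mem_of_adj _ _ ih (by exact_mod_cast h (n + 1)) (R.adj n)

/-- The ray obtained from `R` by deleting its first `M` vertices. -/
def Ray.drop (R : G.Ray) (M : ℕ) : G.Ray where
  toFun n := R.toFun (M + n)
  injective := R.injective.comp (add_right_injective M)
  adj n := R.adj (M + n)

theorem Ray.drop_equivalent (R : G.Ray) (M : ℕ) : (R.drop M).Equivalent R := by
  refine Ray.equivalent_of_forall fun X => ?_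
  obtain ⟨C, N, hN⟩ := R.exists_hasTailIn X
  exact ⟨C, ⟨N, fun n hn => hN (M + n) (by omega)⟩, N, hN⟩

/-- Two rays are separated with respect to a relation `N` between ends if they are disjoint and
`N` does not relate their ends. -/
def Ray.IsSeparated (N : G.EndSpace → G.EndSpace → Prop) (R S : G.Ray) : Prop :=
  (∀ m n, R.toFun m ≠ S.toFun n) ∧ ¬ N (Quotient.mk G.raySetoid R) (Quotient.mk G.raySetoid S)

/-- In a set of pairwise separated rays, the `k`-th vertices of the rays form a dispersed set: of
the rays with their `k`-th vertex near a given end, all but at most one have their tails elsewhere,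
and only finitely many disjoint rays can leave through a finite set of vertices. -/
theorem isDispersed_of_pairwise_isSeparated {N : G.EndSpace → G.EndSpace → Prop}
    (hN : ∀ ω, ∃ X : Finset V, ∀ η ∈ EndSpace.basicOpen X (EndSpace.component X ω),
      ∀ η' ∈ EndSpace.basicOpen X (EndSpace.component X ω), N η η')
    {𝓡 : Set G.Ray} (h𝓡 : 𝓡.Pairwise (Ray.IsSeparated N)) (k : ℕ) :
    G.IsDispersed {v | ∃ R ∈ 𝓡, R.toFun k = v} := by
  classical
  intro R₀
  obtain ⟨X, hX⟩ := hN (Quotient.mk G.raySetoid R₀)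
  set C := EndSpace.component X (Quotient.mk G.raySetoid R₀)
  have htail : {R ∈ 𝓡 | R.HasTailIn C}.Finite := by
    refine Set.Subsingleton.finite fun R hR S hS => ?_
    by_contra hne
    exact (h𝓡 hR.1 hS.1 hne).2 (hX _ (EndSpace.component_mk_eq_iff.2 hR.2) _
      (EndSpace.component_mk_eq_iff.2 hS.2))
  have hmeet : {R ∈ 𝓡 | ∃ n, R.toFun n ∈ X}.Finite := by
    let g : G.Ray → V := fun R => if h : ∃ n, R.toFun n ∈ X then R.toFun h.choose else R.toFun 0
    have hg : ∀ R, ∃ n, g R = R.toFun n := fun R => by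
      by_cases h : ∃ n, R.toFun n ∈ X
      · exact ⟨_, dif_pos h⟩
      · exact ⟨_, dif_neg h⟩
    refine Set.Finite.of_injOn (f := g) (t := (X : Set V)) (fun R hR => ?_) (fun R hR S hS h => ?_)
      X.finite_toSet
    · simp only [g, dif_pos hR.2]
      exact hR.2.choose_spec
    · by_contra hne
      obtain ⟨m, hm⟩ := hg R
      obtain ⟨n, hn⟩ := hg S
      exact (h𝓡 hR.1 hS.1 hne).1 m n (hm.symm.trans (h.trans hn))
  have hfin : {v | v ∈ C ∧ ∃ R ∈ 𝓡, R.toFun k = v}.Finite := by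
    refine ((htail.union hmeet).image fun R => R.toFun k).subset ?_
    rintro _ ⟨hv, R, hR, rfl⟩
    refine ⟨R, ?_, rfl⟩
    obtain ⟨E, hE⟩ := R.exists_hasTailIn X
    by_cases hEC : E = C
    · exact Or.inl ⟨hR, hEC ▸ hE⟩
    · exact Or.inr ⟨hR, Ray.exists_mem_of_hasTailIn_ne hv hE hEC⟩
  obtain ⟨E, hE⟩ := R₀.exists_hasTailIn (X ∪ hfin.toFinset)
  refine ⟨_, E, hE, fun v hv hvU => ComponentCompl.notMem_of_mem hv ?_⟩
  have hvC : v ∈ C :=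
    (EndSpace.hasTailIn_component X R₀).mem_mono Finset.subset_union_left hE hv
  exact Finset.mem_coe.2 (Finset.mem_union_right _ (hfin.mem_toFinset.2 ⟨hvC, hvU⟩))

theorem exists_isNormalTree_isEndFaithful (hG : G.Connected)
    (h : TopologicalSpace.MetrizableSpace G.EndSpace) :
    ∃ (T : G.Subgraph) (r : T.verts), T.IsNormalTree r ∧ T.IsEndFaithful := by
  let _ := TopologicalSpace.metrizableSpaceMetric G.EndSpace
  -- `N n` relates ends of distance less than `1 / (n + 1)`.
  let N : ℕ → G.EndSpace → G.EndSpace → Prop := fun n η η' => Dist.dist η η' < 1 / ((n : ℝ) + 1)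
  have hN : ∀ n ω, ∃ X : Finset V, ∀ η ∈ EndSpace.basicOpen X (EndSpace.component X ω),
      ∀ η' ∈ EndSpace.basicOpen X (EndSpace.component X ω), N n η η' := by
    intro n ω
    have hε : (0 : ℝ) < 1 / ((n : ℝ) + 1) / 2 := by positivity
    obtain ⟨X, hX⟩ := EndSpace.exists_basicOpen_subset Metric.isOpen_ball
      (Metric.mem_ball_self (x := ω) hε)
    refine ⟨X, fun η hη η' hη' => ?_⟩
    have h₁ : Dist.dist η ω < _ := hX hη
    have h₂ : Dist.dist η' ω < _ := hX hη'
    exact (dist_triangle_right η η' ω).trans_lt (by linarith)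
  have hbasis : ∀ (X : Finset V) (ω : G.EndSpace), ∃ n, ∀ η, N n ω η →
      EndSpace.component X η = EndSpace.component X ω := by
    intro X ω
    obtain ⟨ε, hε, hball⟩ := Metric.isOpen_iff.1
      (EndSpace.isOpen_basicOpen X (EndSpace.component X ω)) ω rfl
    obtain ⟨n, hn⟩ := exists_nat_one_div_lt hε
    exact ⟨n, fun η hη => hball (Metric.mem_ball'.2 (lt_trans hη hn))⟩
  have hsymm : ∀ n (R S : G.Ray), Ray.IsSeparated (N n) R S → Ray.IsSeparated (N n) S R :=
    fun n R S h => ⟨fun i j => (h.1 j i).symm, fun h' => h.2 ((_root_.dist_comm _ _).trans_lt h')⟩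
  choose 𝓡 h𝓡 hmax using fun n => exists_maximal_pairwise (Ray.IsSeparated (N n)) (hsymm n)
  obtain ⟨T, r, hT, hU⟩ := exists_isNormalTree_of_isDispersed hG
    (fun i => {v | ∃ R ∈ 𝓡 i.unpair.1, R.toFun i.unpair.2 = v})
    fun i => isDispersed_of_pairwise_isSeparated (hN i.unpair.1) (h𝓡 _) _
  have hmem : ∀ n, ∀ R ∈ 𝓡 n, ∀ k, R.toFun k ∈ T.verts := fun n R hR k =>
    hU (Nat.pair n k) ⟨R, by simpa using hR, by simp⟩
  refine ⟨T, r, hT, hT.injective_inclEnd, hT.surjective_inclEnd fun R X C hR => ?_⟩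
  obtain ⟨M, hM⟩ := hR
  obtain ⟨n, hn⟩ := hbasis X (Quotient.mk G.raySetoid R)
  have hRC : EndSpace.component X (Quotient.mk G.raySetoid R) = C :=
    EndSpace.component_mk_eq_iff.2 ⟨M, hM⟩
  have hdrop : Quotient.mk G.raySetoid (R.drop M) = Quotient.mk G.raySetoid R :=
    Quotient.sound (R.drop_equivalent M)
  have hdropC : ∀ m, (R.drop M).toFun m ∈ C := fun m => hM _ (Nat.le_add_right M m)
  by_cases hRn : R.drop M ∈ 𝓡 n
  · exact ⟨⟨_, hmem n _ hRn 0⟩, hdropC 0⟩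
  -- By maximality some ray `S` of the family meets the tail of `R` in `C` or has an end close to
  -- that of `R`.
  obtain ⟨S, hS, hsep⟩ : ∃ S ∈ 𝓡 n, ¬ Ray.IsSeparated (N n) (R.drop M) S := by
    by_contra! h'
    exact hRn (hmax n _ h')
  rw [Ray.IsSeparated, not_and_or, not_not] at hsep
  rcases hsep with hsep | hsep
  · push Not at hsep
    obtain ⟨i, j, hij⟩ := hsep
    exact ⟨⟨_, hmem n S hS j⟩, show S.toFun j ∈ C from hij ▸ hdropC i⟩
  · rw [hdrop] at hsep
    obtain ⟨k, hk⟩ := EndSpace.component_mk_eq_iff.1 ((hn _ hsep).trans hRC)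
    exact ⟨⟨_, hmem n S hS k⟩, hk k le_rfl⟩

end SimpleGraph

theorem mainTheorem4 {V : Type*} (G : SimpleGraph V) (hG : G.Connected) :
    List.TFAE [
      TopologicalSpace.MetrizableSpace G.EndSpace,
      IsUltrametrizable G.EndSpace,
      ∃ (T : G.Subgraph) (r : T.verts), T.IsNormalTree r ∧ T.IsEndFaithful] := by
  tfae_have 1 → 3 := SimpleGraph.exists_isNormalTree_isEndFaithful hG
  tfae_have 3 → 2 := fun ⟨_, _, hT, hfaithful⟩ => hT.isUltrametrizable hfaithful.surjective
  tfae_have 2 → 1 := fun ⟨d, hd, _⟩ => hd ▸ inferInstance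
  tfae_finish
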